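/- There is an absolute constant $C>0$ for which the following holds. Let $p,n\ge 1$, $V=\{1,\dots,p\}$, and let $F:2^V\to\mathbb R$ be non-decreasing and submodular with $F(\varnothing)=0$ and $F(\{i\})>0$ for all $i\in V$. Let $f$ be the Lovász extension of $F$, i.e. $f(w)=\sum_{k=1}^p w_{j_k}\big(F(\{j_1,\dots,j_k\})-F(\{j_1,\dots,j_{k-1}\})\big)$ where $w_{j_1}\ge\dots\ge w_{j_p}$; let $\Omega_\infty(\theta)=f(|\theta|)$ with $|\theta|$ the entrywise absolute value, let $|P|(F)=\{s\in\mathbb R^p:\sum_{i\in A}|s_i|\le F(A)\ \forall A\subseteq V\}$, and let $G=\mathbb E_{g\sim\mathcal N(0,I_p)}\sup_{s\in|P|(F)}g^\top s$ be its Gaussian width. Let $l(\theta;(x,y))=\ell(\theta^\top x,y)$ be the loss of a generalized linear model, where $\ell(\cdot,y)$ is $L$-Lipschitz for every $y$, $L>0$. Let $Dist$ be a probability distribution of $d=(x,y)\in\mathbb R^p\times\mathbb R$ with $\|x\|_2\le R_2$ almost surely, $R_2>0$, and $\mathbb E\,|l(\theta;d)|<\infty$ for all $\theta$. Let $\epsilon>0$,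 $0<\delta\le 1$, $0<\alpha<1$ and $$\lambda=\frac{LR_2\sqrt n}{G},\qquad \sigma=\frac{4LR_2\sqrt{\log(1/\delta)+\epsilon}}{\lambda\,\epsilon}.$$ For a sample $D=(d_1,\dots,d_n)$ put $$\mathcal L(\theta;D)=\frac1n\sum_{i=1}^n l(\theta;d_i)+\frac{\lambda}{n}\Omega_\infty(\theta),\qquad J(\theta)=\mathbb E_{d\sim Dist}\Big[l(\theta;d)+\frac{\lambda}{n}\Omega_\infty(\theta)\Big].$$ Let $\Theta\subseteq\mathbb R^p$ (for instance $\Theta=\mathbb R^p$), let $B\in\mathbb R$, and let $\theta^*$ be a minimizer of $J$ over $\Theta$ with $\|\theta^*\|_2\le B$. Then, with probability at least $1-\alpha$ over an i.i.d. sample $D\sim Dist^{\,n}$, the following holds for every minimizer $\hat\theta$ of $\mathcal L(\cdot\,;D)$ over $\Theta$ with $\|\hat\theta\|_2\le B$: the output perturbation $\theta^{priv}=\hat\theta+b$, $b\sim\mathcal N(0,\sigma^2I_p)$, satisfies that $J(\theta^{priv})-J(\theta^*)$ is integrable and $$\mathbb E_b\big[J(\theta^{priv})-J(\theta^*)\big]\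 \le\ K\cdot\frac{LR_2\,G\sqrt{\log(1/\delta)+\epsilon}}{\epsilon\sqrt n},\qquad K=C\left(1+\frac{B\,\epsilon\sqrt{\log(2/\alpha)}}{G\sqrt{\log(1/\delta)+\epsilon}}\right).$$ In particular, for fixed $B,\alpha,\epsilon,\delta$ and $F$ the expected excess true risk is $O\!\big(LR_2G\sqrt{\log(1/\delta)+\epsilon}/(\epsilon\sqrt n)\big)$, with an implied constant that depends neither on $n,L,R_2$ nor on the loss and the distribution. -/

import Mathlib

open MeasureTheory ProbabilityTheory

namespace SparsePrivateERM

noncomputable section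

/-- Submodularity of a real-valued set function on `V = {1, …, p}`. -/
def IsSubmodular {p : ℕ} (F : Finset (Fin p) → ℝ) : Prop :=
  ∀ A B : Finset (Fin p), F (A ∪ B) + F (A ∩ B) ≤ F A + F B

/-- The Lovász extension: if `w (τ 0) ≥ w (τ 1) ≥ …`, it is
`∑ k, w (τ k) * (F {τ 0, …, τ k} - F {τ 0, …, τ (k - 1)})`. -/
def lovaszExtension {p : ℕ} (F : Finset (Fin p) → ℝ) (w : Fin p → ℝ) : ℝ :=
  let τ : Equiv.Perm (Fin p) := Tuple.sort (fun i => -w i)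
  ∑ k : Fin p, w (τ k) * (F ((Finset.Iic k).image τ) - F ((Finset.Iio k).image τ))

/-- The regularizer `Ω_∞(θ) = f(|θ|)`, with `f` the Lovász extension of `F`. -/
def omegaInf {p : ℕ} (F : Finset (Fin p) → ℝ) (θ : EuclideanSpace ℝ (Fin p)) : ℝ :=
  lovaszExtension F (fun i => |θ i|)

/-- The symmetric submodular polyhedron `|P|(F)`. -/
def symPolyhedron {p : ℕ} (F : Finset (Fin p) → ℝ) : Set (EuclideanSpace ℝ (Fin p)) :=
  {s | ∀ A : Finset (Fin p), ∑ i ∈ A, |s i| ≤ F A}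

/-- The Gaussian width `E sup_{w ∈ C} ⟨b, w⟩` with `b ∼ N(0, I_p)`. -/
def gaussianWidth {p : ℕ} (C : Set (EuclideanSpace ℝ (Fin p))) : ℝ :=
  ∫ b, (⨆ w : C, inner ℝ b (w : EuclideanSpace ℝ (Fin p)))
    ∂(stdGaussian (EuclideanSpace ℝ (Fin p)))

/-- The Gaussian law `N(0, σ² I_p)`. -/
def isotropicGaussian (p : ℕ) (σ : ℝ) : Measure (EuclideanSpace ℝ (Fin p)) :=
  (stdGaussian (EuclideanSpace ℝ (Fin p))).map (fun b => σ • b)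

/-- A data point `(x, y)`. -/
abbrev DataPoint (p : ℕ) : Type := EuclideanSpace ℝ (Fin p) × ℝ

/-- The loss `l(θ; (x, y)) = ℓ(θᵀx, y)` of a generalized linear model. -/
def glmLoss {p : ℕ} (ℓ : ℝ → ℝ → ℝ) (θ : EuclideanSpace ℝ (Fin p)) (d : DataPoint p) : ℝ :=
  ℓ (inner ℝ θ d.1) d.2

/-- The regularized empirical risk `(1/n) ∑ l(θ; d_i) + (lam/n) Ω_∞(θ)`. -/
def empRisk {p n : ℕ} (ℓ : ℝ → ℝ → ℝ) (F : Finset (Fin p) → ℝ) (lam : ℝ)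
    (D : Fin n → DataPoint p) (θ : EuclideanSpace ℝ (Fin p)) : ℝ :=
  (1 / (n : ℝ)) * ∑ i, glmLoss ℓ θ (D i) + lam / n * omegaInf F θ

/-- The regularized true risk `J(θ) = E_{d ∼ Dist} [l(θ; d) + (lam/n) Ω_∞(θ)]`. -/
def trueRisk {p : ℕ} (n : ℕ) (ℓ : ℝ → ℝ → ℝ) (F : Finset (Fin p) → ℝ) (lam : ℝ)
    (Dist : Measure (DataPoint p)) (θ : EuclideanSpace ℝ (Fin p)) : ℝ :=
  ∫ d, (glmLoss ℓ θ d + lam / n * omegaInf F θ) ∂Dist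

/-- `θ` is a minimizer of `g` over the domain `Θ`. -/
def IsArgmin {p : ℕ} (g : EuclideanSpace ℝ (Fin p) → ℝ) (Θ : Set (EuclideanSpace ℝ (Fin p)))
    (θ : EuclideanSpace ℝ (Fin p)) : Prop :=
  θ ∈ Θ ∧ ∀ θ' ∈ Θ, g θ ≤ g θ'

end

end SparsePrivateERM

/-
Comparing the empirical risks of a minimizer and of the comparator reduces the generalization error
to a deviation of centered sums of loss differences, uniform over a ball. As a generalized linear
loss depends on `θ` only through a Lipschitz function of `⟨θ, x⟩`, one data point at a time can be
symmetrized and contracted inside the exponential of the supremum; this replaces the losses by a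
Rademacher walk of the vectors `x`. The supremum of a linear functional over a ball is a norm, and
`cosh ‖·‖` grows along such a walk at most by the factor `cosh ‖x‖` per step, in any dimension, so
the resulting Chernoff bound is dimension-free.

By the greedy algorithm `Ω_∞` is the support function of `|P|(F)`, so Gaussian noise of level `σ`
raises the regularizer by at most `σ G`; it raises the loss by at most `L σ E|⟨b, x⟩| ≤ L σ R₂`.
-/

namespace SparsePrivateERM

open scoped ENNReal

section Convexity

lemma convexOn_add_le_add_of_mem_segment {V : Type*} [AddCommGroup V] [Module ℝ V] {s : Set V}
    {f : V → ℝ} (hf : ConvexOn ℝ s f) {x x' y z : V} (hy : y ∈ s) (hz : z ∈ s)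
    (hx : x ∈ segment ℝ y z) (h : x + x' = y + z) : f x + f x' ≤ f y + f z := by
  obtain ⟨a, b, ha, hb, hab, rfl⟩ := hx
  obtain rfl : b = 1 - a := by linarith
  have hx' : x' = (1 - a) • y + a • z := by
    rw [eq_sub_of_add_eq' h]
    module
  have h₁ := hf.2 hy hz ha hb hab
  have h₂ := hf.2 hy hz hb ha (by ring)
  rw [hx']
  simp only [smul_eq_mul] at h₁ h₂
  linear_combination h₁ + h₂

lemma exp_add_exp_le_of_le_max {x₁ x₂ y₁ y₂ : ℝ} (hsum : x₁ + x₂ ≤ y₁ + y₂)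
    (h₁ : x₁ ≤ max y₁ y₂) (h₂ : x₂ ≤ max y₁ y₂) :
    Real.exp x₁ + Real.exp x₂ ≤ Real.exp y₁ + Real.exp y₂ := by
  wlog hy : y₂ ≤ y₁ generalizing y₁ y₂
  · rw [add_comm (Real.exp y₁)]
    exact this (by linarith) (max_comm y₁ y₂ ▸ h₁) (max_comm y₁ y₂ ▸ h₂) (not_le.1 hy).le
  rw [max_eq_left hy] at h₁ h₂
  rcases le_total x₂ y₂ with h | h
  · exact add_le_add (Real.exp_le_exp.2 h₁) (Real.exp_le_exp.2 h)
  · calc Real.exp x₁ + Real.exp x₂ ≤ Real.exp (y₁ + y₂ - x₂) + Real.exp x₂ := by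
          gcongr; linarith
      _ = Real.exp x₂ + Real.exp (y₁ + y₂ - x₂) := add_comm _ _
      _ ≤ Real.exp y₂ + Real.exp y₁ :=
          convexOn_add_le_add_of_mem_segment convexOn_exp trivial trivial
            (by rw [segment_eq_Icc hy]; exact ⟨h, h₂⟩) (by ring)
      _ = Real.exp y₁ + Real.exp y₂ := add_comm _ _

lemma cosh_add_cosh_le_of_sq_add_sq_eq {a b A B : ℝ} (hBa : B ^ 2 ≤ a ^ 2) (hBb : B ^ 2 ≤ b ^ 2)
    (hsum : a ^ 2 + b ^ 2 = A ^ 2 + B ^ 2) :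
    Real.cosh a + Real.cosh b ≤ Real.cosh A + Real.cosh B := by
  refine hasSum_le (fun k => ?_) ((Real.hasSum_cosh a).add (Real.hasSum_cosh b))
    ((Real.hasSum_cosh A).add (Real.hasSum_cosh B))
  have ha : a ^ 2 ∈ segment ℝ (A ^ 2) (B ^ 2) := by
    rw [segment_symm, segment_eq_Icc (by linarith)]
    exact ⟨hBa, by linarith⟩
  simp only [pow_mul, ← add_div]
  exact div_le_div_of_nonneg_right
    (convexOn_add_le_add_of_mem_segment (convexOn_pow k) (sq_nonneg A) (sq_nonneg B) ha hsum)
    (Nat.cast_nonneg _)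

lemma cosh_norm_add_add_cosh_norm_sub_le {E : Type*} [NormedAddCommGroup E]
    [InnerProductSpace ℝ E] (c : ℝ) (u : E) {x : E} {R : ℝ} (hx : ‖x‖ ≤ R) :
    Real.cosh (c * ‖u + x‖) + Real.cosh (c * ‖u - x‖)
      ≤ 2 * (Real.cosh (c * ‖u‖) * Real.cosh (c * R)) := by
  have h_add : (c * ‖u‖ - c * ‖x‖) ^ 2 ≤ (c * ‖u + x‖) ^ 2 := by
    rw [← mul_sub, mul_pow, mul_pow]
    gcongr ?_ * ?_
    rw [sq_le_sq, abs_norm]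
    simpa using abs_norm_sub_norm_le u (-x)
  have h_sub : (c * ‖u‖ - c * ‖x‖) ^ 2 ≤ (c * ‖u - x‖) ^ 2 := by
    rw [← mul_sub, mul_pow, mul_pow]
    gcongr ?_ * ?_
    rw [sq_le_sq, abs_norm]
    exact abs_norm_sub_norm_le u x
  calc Real.cosh (c * ‖u + x‖) + Real.cosh (c * ‖u - x‖)
      ≤ Real.cosh (c * ‖u‖ + c * ‖x‖) + Real.cosh (c * ‖u‖ - c * ‖x‖) :=
        cosh_add_cosh_le_of_sq_add_sq_eq h_add h_sub
          (by linear_combination c ^ 2 * parallelogram_law_with_norm ℝ u x)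
    _ = 2 * (Real.cosh (c * ‖u‖) * Real.cosh (c * ‖x‖)) := by
        rw [Real.cosh_add, Real.cosh_sub]
        ring
    _ ≤ 2 * (Real.cosh (c * ‖u‖) * Real.cosh (c * R)) := by
        have hR : Real.cosh (c * ‖x‖) ≤ Real.cosh (c * R) := by
          rw [Real.cosh_le_cosh, abs_mul, abs_mul, abs_norm]
          gcongr
          exact hx.trans (le_abs_self R)
        gcongr

end Convexity

section ExponentialMoment

variable {ι X : Type*}

/-- The supremum of the exponentials of a family of reals. It takes values in `ℝ≥0∞`, so that
infinite and unbounded families need no separate treatment. -/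
noncomputable def supExp (a : ι → ℝ) : ℝ≥0∞ := ⨆ i, ENNReal.ofReal (Real.exp (a i))

lemma ofReal_exp_le_supExp (a : ι → ℝ) (i : ι) :
    ENNReal.ofReal (Real.exp (a i)) ≤ supExp a :=
  le_iSup (fun i => ENNReal.ofReal (Real.exp (a i))) i

lemma supExp_le {a : ι → ℝ} {c : ℝ} (h : ∀ i, Real.exp (a i) ≤ c) :
    supExp a ≤ ENNReal.ofReal c :=
  iSup_le fun i => ENNReal.ofReal_le_ofReal (h i)

lemma supExp_midpoint_le (a b : ι → ℝ) :
    supExp (fun i => (a i + b i) / 2) ≤ 2⁻¹ * (supExp a + supExp b) := by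
  refine iSup_le fun i => ?_
  have hconv : Real.exp ((a i + b i) / 2) ≤ 2⁻¹ * (Real.exp (a i) + Real.exp (b i)) := by
    have h := convexOn_exp.2 (Set.mem_univ (a i)) (Set.mem_univ (b i))
      (inv_nonneg.2 zero_le_two) (inv_nonneg.2 zero_le_two) (by norm_num)
    simp only [smul_eq_mul, ← mul_add] at h
    rwa [div_eq_inv_mul]
  refine (ENNReal.ofReal_le_ofReal hconv).trans ?_
  rw [ENNReal.ofReal_mul (by norm_num), ENNReal.ofReal_inv_of_pos two_pos, ENNReal.ofReal_ofNat,
    ENNReal.ofReal_add (Real.exp_pos _).le (Real.exp_pos _).le]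
  gcongr <;> exact ofReal_exp_le_supExp _ i

lemma supExp_contraction {a h s : ι → ℝ} (hs : ∀ i, |h i| ≤ |s i|)
    (hd : ∀ i j, |h i - h j| ≤ |s i - s j|) :
    supExp (fun i => a i + h i) + supExp (fun i => a i - h i)
      ≤ supExp (fun i => a i + s i) + supExp (fun i => a i - s i) := by
  rcases isEmpty_or_nonempty ι with hι | hι
  · simp [supExp]
  refine ENNReal.iSup_add_iSup_le fun i j => ?_
  have hle_max : ∀ k, a k + |s k| ≤ max (a k + s k) (a k - s k) := fun k => by
    rw [sub_eq_add_neg, max_add_add_left, abs_eq_max_neg]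
  have hreal := exp_add_exp_le_of_le_max (x₁ := a i + h i) (x₂ := a j - h j)
    (y₁ := max (a i + s i) (a j + s j)) (y₂ := max (a i - s i) (a j - s j)) ?_ ?_ ?_
  · have hmax : ∀ b : ι → ℝ, ENNReal.ofReal (Real.exp (max (b i) (b j))) ≤ supExp b := fun b => by
      rcases max_choice (b i) (b j) with e | e <;> rw [e] <;> exact ofReal_exp_le_supExp b _
    rw [← ENNReal.ofReal_add (Real.exp_pos _).le (Real.exp_pos _).le]
    refine (ENNReal.ofReal_le_ofReal hreal).trans ?_
    rw [ENNReal.ofReal_add (Real.exp_pos _).le (Real.exp_pos _).le]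
    exact add_le_add (hmax fun k => a k + s k) (hmax fun k => a k - s k)
  · have hij := (le_abs_self _).trans (hd i j)
    rcases abs_cases (s i - s j) with ⟨e, -⟩ | ⟨e, -⟩ <;> rw [e] at hij
    · linarith [le_max_left (a i + s i) (a j + s j), le_max_right (a i - s i) (a j - s j)]
    · linarith [le_max_right (a i + s i) (a j + s j), le_max_left (a i - s i) (a j - s j)]
  · calc a i + h i ≤ a i + |s i| := by linarith [hs i, le_abs_self (h i)]
      _ ≤ _ := (hle_max i).trans (max_le_max (le_max_left _ _) (le_max_left _ _))
  · calc a j - h j ≤ a j + |s j| := by linarith [hs j, neg_abs_le (h j)]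
      _ ≤ _ := (hle_max j).trans (max_le_max (le_max_right _ _) (le_max_right _ _))

variable [MeasurableSpace X] {μ : Measure X}

lemma aemeasurable_supExp [Countable ι] {a : ι → X → ℝ} (ha : ∀ i, AEMeasurable (a i) μ) :
    AEMeasurable (fun d => supExp fun i => a i d) μ :=
  AEMeasurable.iSup fun i => (Real.measurable_exp.comp_aemeasurable (ha i)).ennreal_ofReal

lemma ofReal_integral_le_lintegral_ofReal {f : X → ℝ} (hf : Integrable f μ) :
    ENNReal.ofReal (∫ d, f d ∂μ) ≤ ∫⁻ d, ENNReal.ofReal (f d) ∂μ := by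
  rw [integral_eq_lintegral_pos_part_sub_lintegral_neg_part hf]
  exact ENNReal.ofReal_le_of_le_toReal (sub_le_self _ ENNReal.toReal_nonneg)

lemma ofReal_exp_integral_le_lintegral [IsProbabilityMeasure μ] {f : X → ℝ}
    (hf : Integrable f μ) :
    ENNReal.ofReal (Real.exp (∫ d, f d ∂μ)) ≤ ∫⁻ d, ENNReal.ofReal (Real.exp (f d)) ∂μ := by
  set m := ∫ d, f d ∂μ with hm
  have htangent : ∀ d, Real.exp m * (1 + (f d - m)) ≤ Real.exp (f d) := fun d => by
    have h := Real.add_one_le_exp (f d - m)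
    calc Real.exp m * (1 + (f d - m)) ≤ Real.exp m * Real.exp (f d - m) := by
          gcongr; linarith
      _ = Real.exp (f d) := by rw [← Real.exp_add]; congr 1; ring
  have hint : Integrable (fun d => f d - m) μ := hf.sub (integrable_const m)
  have hmean : ∫ d, Real.exp m * (1 + (f d - m)) ∂μ = Real.exp m := by
    rw [integral_const_mul, integral_add (integrable_const 1) hint,
      integral_sub hf (integrable_const m)]
    simp [hm]
  calc ENNReal.ofReal (Real.exp m)
      = ENNReal.ofReal (∫ d, Real.exp m * (1 + (f d - m)) ∂μ) := by rw [hmean]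
    _ ≤ ∫⁻ d, ENNReal.ofReal (Real.exp m * (1 + (f d - m))) ∂μ :=
        ofReal_integral_le_lintegral_ofReal (((integrable_const 1).add hint).const_mul _)
    _ ≤ ∫⁻ d, ENNReal.ofReal (Real.exp (f d)) ∂μ :=
        lintegral_mono fun d => ENNReal.ofReal_le_ofReal (htangent d)

lemma lintegral_pi_succ [SigmaFinite μ] {n : ℕ} {g : (Fin (n + 1) → X) → ℝ≥0∞}
    (hg : AEMeasurable g (Measure.pi fun _ => μ)) :
    ∫⁻ D, g D ∂(Measure.pi fun _ => μ)
      = ∫⁻ D, ∫⁻ d, g (Fin.cons d D) ∂μ ∂(Measure.pi fun _ : Fin n => μ) := by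
  have hmp := (measurePreserving_piFinSuccAbove (fun _ : Fin (n + 1) => μ) 0).symm
  have hg' := hg.comp_quasiMeasurePreserving hmp.quasiMeasurePreserving
  rw [← hmp.lintegral_comp_emb (MeasurableEquiv.measurableEmbedding _)]
  refine (lintegral_prod_symm _ hg').trans (lintegral_congr fun D => lintegral_congr fun d => ?_)
  rw [Function.comp_apply, MeasurableEquiv.piFinSuccAbove_symm_apply, Fin.insertNthEquiv_zero]
  rfl

/-- The sum over the sample `D` of the deviations of `h` from its mean, the unnormalized difference
between the population mean and the empirical mean. -/
noncomputable def centeredSum (μ : Measure X) (h : X → ℝ) {n : ℕ} (D : Fin n → X) : ℝ :=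
  ∑ k, (∫ d, h d ∂μ - h (D k))

lemma centeredSum_cons (h : X → ℝ) {n : ℕ} (d : X) (D : Fin n → X) :
    centeredSum μ h (Fin.cons d D : Fin (n + 1) → X)
      = centeredSum μ h D + (∫ d', h d' ∂μ - h d) := by
  simp only [centeredSum, Fin.sum_univ_succ, Fin.cons_zero, Fin.cons_succ]
  ring

lemma centeredSum_const_mul (h : X → ℝ) (t : ℝ) {n : ℕ} (D : Fin n → X) :
    centeredSum μ (fun d => t * h d) D = t * centeredSum μ h D := by
  simp only [centeredSum, integral_const_mul, ← mul_sub, Finset.mul_sum]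

lemma aemeasurable_centeredSum [SigmaFinite μ] {h : X → ℝ} (hh : AEMeasurable h μ) (n : ℕ) :
    AEMeasurable (centeredSum μ h (n := n)) (Measure.pi fun _ => μ) :=
  Finset.aemeasurable_fun_sum _ fun k _ =>
    (hh.comp_quasiMeasurePreserving (Measure.quasiMeasurePreserving_eval _ k)).const_sub _

variable [IsProbabilityMeasure μ]

lemma supExp_integral_le_lintegral {f : ι → X → ℝ} (hf : ∀ i, Integrable (f i) μ) :
    supExp (fun i => ∫ d, f i d ∂μ) ≤ ∫⁻ d, supExp (fun i => f i d) ∂μ :=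
  iSup_le fun i => (ofReal_exp_integral_le_lintegral (hf i)).trans <|
    lintegral_mono fun d => ofReal_exp_le_supExp (fun i => f i d) i

lemma lintegral_supExp_centered_le [Countable ι] {a : ι → ℝ} {h s : ι → X → ℝ}
    (hint : ∀ i, Integrable (h i) μ) (hs : ∀ i d, |h i d| ≤ |s i d|)
    (hd : ∀ i j d, |h i d - h j d| ≤ |s i d - s j d|) :
    ∫⁻ d, supExp (fun i => a i + (∫ d', h i d' ∂μ - h i d)) ∂μ
      ≤ 2⁻¹ * ∫⁻ d, (supExp (fun i => a i + 2 * s i d) + supExp fun i => a i - 2 * s i d) ∂μ := by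
  have hint₂ : ∀ i, Integrable (fun d => a i + 2 * h i d) μ := fun i =>
    (integrable_const _).add ((hint i).const_mul 2)
  have hjensen : supExp (fun i => a i + 2 * ∫ d, h i d ∂μ)
      ≤ ∫⁻ d, supExp (fun i => a i + 2 * h i d) ∂μ := by
    refine le_of_eq_of_le (congrArg supExp (funext fun i => ?_))
      (supExp_integral_le_lintegral hint₂)
    rw [integral_add (integrable_const _) ((hint i).const_mul 2), integral_const_mul]
    simp
  have hmid : ∀ d, supExp (fun i => a i + (∫ d', h i d' ∂μ - h i d))
      ≤ 2⁻¹ * (∫⁻ d', supExp (fun i => a i + 2 * h i d') ∂μ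
        + supExp fun i => a i - 2 * h i d) := fun d =>
    calc supExp (fun i => a i + (∫ d', h i d' ∂μ - h i d))
        = supExp fun i => ((a i + 2 * ∫ d', h i d' ∂μ) + (a i - 2 * h i d)) / 2 :=
          congrArg supExp (funext fun i => by ring)
      _ ≤ _ := (supExp_midpoint_le _ _).trans (by gcongr)
  have hcontr : ∀ d, supExp (fun i => a i + 2 * h i d) + supExp (fun i => a i - 2 * h i d)
      ≤ supExp (fun i => a i + 2 * s i d) + supExp fun i => a i - 2 * s i d := fun d =>
    supExp_contraction (fun i => by simpa [abs_mul] using hs i d)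
      (fun i j => by simpa [abs_mul, ← mul_sub] using hd i j d)
  calc ∫⁻ d, supExp (fun i => a i + (∫ d', h i d' ∂μ - h i d)) ∂μ
      ≤ ∫⁻ d, 2⁻¹ * (∫⁻ d', supExp (fun i => a i + 2 * h i d') ∂μ
          + supExp fun i => a i - 2 * h i d) ∂μ := lintegral_mono hmid
    _ = 2⁻¹ * ∫⁻ d, (supExp (fun i => a i + 2 * h i d)
          + supExp fun i => a i - 2 * h i d) ∂μ := by
        rw [lintegral_const_mul' _ _ (by simp), lintegral_add_left measurable_const,
          lintegral_const, measure_univ, mul_one,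
          lintegral_add_left' (aemeasurable_supExp fun i => (hint₂ i).aemeasurable)]
    _ ≤ _ := mul_le_mul_right (lintegral_mono hcontr) _

lemma lintegral_pi_succ_supExp_le [Countable ι] {a : ι → ℝ} {h s : ι → X → ℝ}
    (hint : ∀ i, Integrable (h i) μ) (hmeas : ∀ i, AEMeasurable (s i) μ)
    (hs : ∀ i d, |h i d| ≤ |s i d|) (hd : ∀ i j d, |h i d - h j d| ≤ |s i d - s j d|) (n : ℕ) :
    ∫⁻ D, supExp (fun i => a i + centeredSum μ (h i) D) ∂(Measure.pi fun _ : Fin (n + 1) => μ)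
      ≤ 2⁻¹ * ∫⁻ d, (∫⁻ D, supExp (fun i => a i + 2 * s i d + centeredSum μ (h i) D)
            ∂(Measure.pi fun _ : Fin n => μ)
          + ∫⁻ D, supExp (fun i => a i - 2 * s i d + centeredSum μ (h i) D)
            ∂(Measure.pi fun _ : Fin n => μ)) ∂μ := by
  set P := Measure.pi fun _ : Fin n => μ
  have hsum := fun i n => aemeasurable_centeredSum (hint i).aemeasurable n
  have hpos : AEMeasurable (fun z : (Fin n → X) × X =>
      supExp fun i => a i + centeredSum μ (h i) z.1 + 2 * s i z.2) (P.prod μ) :=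
    aemeasurable_supExp fun i => ((hsum i n).comp_fst.const_add _).add
      ((hmeas i).comp_snd.const_mul 2)
  have hneg : AEMeasurable (fun z : (Fin n → X) × X =>
      supExp fun i => a i + centeredSum μ (h i) z.1 - 2 * s i z.2) (P.prod μ) :=
    aemeasurable_supExp fun i => ((hsum i n).comp_fst.const_add _).sub
      ((hmeas i).comp_snd.const_mul 2)
  calc _ = ∫⁻ D, ∫⁻ d, supExp (fun i =>
          a i + centeredSum μ (h i) D + (∫ d', h i d' ∂μ - h i d)) ∂μ ∂P := by
        rw [lintegral_pi_succ (aemeasurable_supExp fun i => (hsum i (n + 1)).const_add _)]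
        simp only [centeredSum_cons, add_assoc]
        rfl
    _ ≤ ∫⁻ D, 2⁻¹ * ∫⁻ d, (supExp (fun i => a i + centeredSum μ (h i) D + 2 * s i d)
          + supExp fun i => a i + centeredSum μ (h i) D - 2 * s i d) ∂μ ∂P :=
        lintegral_mono fun D => lintegral_supExp_centered_le hint hs hd
    _ = 2⁻¹ * ∫⁻ d, ∫⁻ D, (supExp (fun i => a i + centeredSum μ (h i) D + 2 * s i d)
          + supExp fun i => a i + centeredSum μ (h i) D - 2 * s i d) ∂P ∂μ := by
        rw [lintegral_const_mul' _ _ (by simp), lintegral_lintegral_swap (hpos.add hneg)]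
    _ = _ := by
        simp only [add_right_comm _ (centeredSum _ _ _), add_sub_right_comm]
        congr 2 with d
        refine lintegral_add_left' ?_ _
        exact aemeasurable_supExp fun i => (hsum i n).const_add _

variable {E : Type*} [NormedAddCommGroup E] [InnerProductSpace ℝ E]

lemma supExp_inner_le {w : ι → E} {ρ : ℝ} (hw : ∀ i, ‖w i‖ ≤ ρ) (u : E) :
    supExp (fun i => inner ℝ (w i) u) ≤ ENNReal.ofReal (2 * Real.cosh (ρ * ‖u‖)) := by
  refine supExp_le fun i => ?_
  calc Real.exp (inner ℝ (w i) u) ≤ Real.exp (ρ * ‖u‖) := by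
        gcongr
        exact (real_inner_le_norm _ _).trans (by gcongr; exact hw i)
    _ ≤ 2 * Real.cosh (ρ * ‖u‖) := by
        rw [Real.cosh_eq]
        linarith [Real.exp_pos (-(ρ * ‖u‖))]

lemma lintegral_supExp_inner_add_centeredSum_le [Countable ι] {x : X → E}
    (hx : AEStronglyMeasurable x μ) {R : ℝ} (hxR : ∀ᵐ d ∂μ, ‖x d‖ ≤ R) {w : ι → E} {ρ : ℝ}
    (hw : ∀ i, ‖w i‖ ≤ ρ) {h : ι → X → ℝ} (hint : ∀ i, Integrable (h i) μ)
    (hle : ∀ i d, |h i d| ≤ |inner ℝ (w i) (x d)|)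
    (hd : ∀ i j d, |h i d - h j d| ≤ |inner ℝ (w i - w j) (x d)|) (n : ℕ) (u : E) :
    ∫⁻ D, supExp (fun i => inner ℝ (w i) u + centeredSum μ (h i) D)
        ∂(Measure.pi fun _ : Fin n => μ)
      ≤ ENNReal.ofReal (2 * Real.cosh (ρ * ‖u‖) * Real.cosh (ρ * (2 * R)) ^ n) := by
  induction n generalizing u with
  | zero => simpa [centeredSum] using supExp_inner_le hw u
  | succ n ih =>
    refine (lintegral_pi_succ_supExp_le hint (fun i => (hx.const_inner (c := w i)).aemeasurable) hle
      (fun i j d => by rw [← inner_sub_left]; exact hd i j d) n).trans ?_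
    have hstep : ∀ᵐ d ∂μ,
        ∫⁻ D, supExp (fun i => inner ℝ (w i) u + 2 * inner ℝ (w i) (x d) + centeredSum μ (h i) D)
            ∂(Measure.pi fun _ : Fin n => μ)
          + ∫⁻ D, supExp (fun i => inner ℝ (w i) u - 2 * inner ℝ (w i) (x d)
            + centeredSum μ (h i) D) ∂(Measure.pi fun _ : Fin n => μ)
        ≤ ENNReal.ofReal (4 * Real.cosh (ρ * ‖u‖) * Real.cosh (ρ * (2 * R)) ^ (n + 1)) := by
      filter_upwards [hxR] with d hdR
      simp only [← real_inner_smul_right, ← inner_add_right, ← inner_sub_right]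
      refine (add_le_add (ih _) (ih _)).trans ?_
      rw [← ENNReal.ofReal_add (by positivity) (by positivity)]
      refine ENNReal.ofReal_le_ofReal ?_
      have hdR₂ : ‖(2 : ℝ) • x d‖ ≤ 2 * R := by
        rw [norm_smul, Real.norm_two]
        gcongr
      calc 2 * Real.cosh (ρ * ‖u + (2 : ℝ) • x d‖) * Real.cosh (ρ * (2 * R)) ^ n
            + 2 * Real.cosh (ρ * ‖u - (2 : ℝ) • x d‖) * Real.cosh (ρ * (2 * R)) ^ n
          = 2 * (Real.cosh (ρ * ‖u + (2 : ℝ) • x d‖) + Real.cosh (ρ * ‖u - (2 : ℝ) • x d‖))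
            * Real.cosh (ρ * (2 * R)) ^ n := by ring
        _ ≤ 2 * (2 * (Real.cosh (ρ * ‖u‖) * Real.cosh (ρ * (2 * R))))
            * Real.cosh (ρ * (2 * R)) ^ n := by
          gcongr
          exact cosh_norm_add_add_cosh_norm_sub_le ρ u hdR₂
        _ = 4 * Real.cosh (ρ * ‖u‖) * Real.cosh (ρ * (2 * R)) ^ (n + 1) := by ring
    refine (mul_le_mul_right (lintegral_mono_ae hstep) _).trans_eq ?_
    rw [lintegral_const, measure_univ, mul_one, ← ENNReal.ofReal_ofNat 2,
      ← ENNReal.ofReal_inv_of_pos two_pos, ← ENNReal.ofReal_mul (by norm_num)]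
    congr 1
    ring

lemma lintegral_supExp_mul_centeredSum_le [Countable ι] {x : X → E}
    (hx : AEStronglyMeasurable x μ) {R : ℝ} (hxR : ∀ᵐ d ∂μ, ‖x d‖ ≤ R) {w : ι → E} {ρ : ℝ}
    (hw : ∀ i, ‖w i‖ ≤ ρ) {h : ι → X → ℝ} (hint : ∀ i, Integrable (h i) μ)
    (hle : ∀ i d, |h i d| ≤ |inner ℝ (w i) (x d)|)
    (hd : ∀ i j d, |h i d - h j d| ≤ |inner ℝ (w i - w j) (x d)|) (n : ℕ) {t : ℝ} (ht : 0 ≤ t) :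
    ∫⁻ D, supExp (fun i => t * centeredSum μ (h i) D) ∂(Measure.pi fun _ : Fin n => μ)
      ≤ ENNReal.ofReal (2 * Real.exp (2 * n * (t * (ρ * R)) ^ 2)) := by
  have hbound := lintegral_supExp_inner_add_centeredSum_le (hx.const_smul t) (R := t * R)
    (h := fun i d => t * h i d) (by
      filter_upwards [hxR] with d hdR
      rw [Pi.smul_apply, norm_smul, Real.norm_of_nonneg ht]
      gcongr) hw (fun i => (hint i).const_mul t)
    (fun i d => by
      rw [Pi.smul_apply, real_inner_smul_right, abs_mul, abs_mul]
      exact mul_le_mul_of_nonneg_left (hle i d) (abs_nonneg t))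
    (fun i j d => by
      rw [Pi.smul_apply, real_inner_smul_right, ← mul_sub, abs_mul, abs_mul]
      exact mul_le_mul_of_nonneg_left (hd i j d) (abs_nonneg t)) n 0
  simp only [inner_zero_right, zero_add, norm_zero, mul_zero, Real.cosh_zero, mul_one,
    centeredSum_const_mul] at hbound
  refine hbound.trans (ENNReal.ofReal_le_ofReal ?_)
  calc 2 * Real.cosh (ρ * (2 * (t * R))) ^ n
      ≤ 2 * Real.exp ((ρ * (2 * (t * R))) ^ 2 / 2) ^ n := by
        gcongr
        exact Real.cosh_le_exp_half_sq _
    _ = 2 * Real.exp (2 * n * (t * (ρ * R)) ^ 2) := by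
        rw [← Real.exp_nat_mul]
        ring_nf

lemma measure_exists_lt_centeredSum_le [Countable ι] {x : X → E}
    (hx : AEStronglyMeasurable x μ) {R : ℝ} (hxR : ∀ᵐ d ∂μ, ‖x d‖ ≤ R) {w : ι → E} {ρ : ℝ}
    (hw : ∀ i, ‖w i‖ ≤ ρ) {h : ι → X → ℝ} (hint : ∀ i, Integrable (h i) μ)
    (hle : ∀ i d, |h i d| ≤ |inner ℝ (w i) (x d)|)
    (hd : ∀ i j d, |h i d - h j d| ≤ |inner ℝ (w i - w j) (x d)|) (n : ℕ) {c : ℝ} (hc : 0 ≤ c) :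
    Measure.pi (fun _ : Fin n => μ) {D | ∃ i, c < centeredSum μ (h i) D}
      ≤ ENNReal.ofReal (2 * Real.exp (-(c ^ 2 / (8 * n * (ρ * R) ^ 2)))) := by
  -- `t` minimizes the exponent `2 * n * (t * (ρ * R)) ^ 2 - t * c` of the Chernoff bound.
  set t := c / (4 * n * (ρ * R) ^ 2) with ht_def
  have ht : 0 ≤ t := by positivity
  have hmeas : AEMeasurable (fun D : Fin n → X => supExp fun i => t * centeredSum μ (h i) D)
      (Measure.pi fun _ => μ) :=
    aemeasurable_supExp fun i => (aemeasurable_centeredSum (hint i).aemeasurable n).const_mul t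
  calc Measure.pi (fun _ : Fin n => μ) {D | ∃ i, c < centeredSum μ (h i) D}
      ≤ Measure.pi (fun _ : Fin n => μ)
          {D | ENNReal.ofReal (Real.exp (t * c)) ≤ supExp fun i => t * centeredSum μ (h i) D} := by
        refine measure_mono fun D ⟨i, hi⟩ => le_trans ?_ (ofReal_exp_le_supExp _ i)
        gcongr
    _ ≤ ENNReal.ofReal (2 * Real.exp (2 * n * (t * (ρ * R)) ^ 2))
          / ENNReal.ofReal (Real.exp (t * c)) :=
        (meas_ge_le_lintegral_div hmeas (by simp [Real.exp_pos]) ENNReal.ofReal_ne_top).trans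
          (by gcongr; exact lintegral_supExp_mul_centeredSum_le hx hxR hw hint hle hd n ht)
    _ = ENNReal.ofReal (2 * Real.exp (-(c ^ 2 / (8 * n * (ρ * R) ^ 2)))) := by
        rw [← ENNReal.ofReal_div_of_pos (Real.exp_pos _), mul_div_assoc, ← Real.exp_sub]
        congr 3
        rcases eq_or_ne (n * (ρ * R) ^ 2) 0 with h₀ | h₀
        · have : t = 0 := by rw [ht_def, mul_assoc, h₀, mul_zero, div_zero]
          rw [this, mul_assoc 8, h₀]
          simp
        · rw [ht_def]
          have := left_ne_zero_of_mul h₀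
          have := right_ne_zero_of_mul h₀
          field_simp
          ring

end ExponentialMoment

section UniformDeviation

variable {X E : Type*} [MeasurableSpace X] {μ : Measure X} [IsProbabilityMeasure μ]
  [NormedAddCommGroup E] [InnerProductSpace ℝ E] {x : X → E} {R : ℝ} {f : E → X → ℝ}

lemma lipschitzWith_integral_of_abs_sub_le_inner (hxR : ∀ᵐ d ∂μ, ‖x d‖ ≤ R)
    (hf : ∀ θ θ' d, |f θ d - f θ' d| ≤ |inner ℝ (θ - θ') (x d)|)
    (hint : ∀ θ, Integrable (f θ) μ) :
    LipschitzWith R.toNNReal fun θ => ∫ d, f θ d ∂μ :=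
  LipschitzWith.of_dist_le' fun θ θ' => by
    rw [dist_eq_norm, dist_eq_norm, ← integral_sub (hint θ) (hint θ')]
    refine (norm_integral_le_of_norm_le_const (C := R * ‖θ - θ'‖) ?_).trans_eq (by simp)
    filter_upwards [hxR] with d hdR
    calc ‖f θ d - f θ' d‖ ≤ |inner ℝ (θ - θ') (x d)| := hf θ θ' d
      _ ≤ ‖θ - θ'‖ * ‖x d‖ := abs_real_inner_le_norm _ _
      _ ≤ R * ‖θ - θ'‖ := by rw [mul_comm]; gcongr

lemma continuous_centeredSum_sub (hxR : ∀ᵐ d ∂μ, ‖x d‖ ≤ R)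
    (hf : ∀ θ θ' d, |f θ d - f θ' d| ≤ |inner ℝ (θ - θ') (x d)|)
    (hint : ∀ θ, Integrable (f θ) μ) (θ₀ : E) {n : ℕ} (D : Fin n → X) :
    Continuous fun θ => centeredSum μ (fun d => f θ d - f θ₀ d) D := by
  have hpoint : ∀ d, Continuous fun θ => f θ d := fun d =>
    (LipschitzWith.of_dist_le' (K := ‖x d‖) fun θ θ' => by
      rw [dist_eq_norm, dist_eq_norm, mul_comm]
      exact (hf θ θ' d).trans (abs_real_inner_le_norm _ _)).continuous
  have hmean := (lipschitzWith_integral_of_abs_sub_le_inner hxR hf hint).continuous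
  simp only [centeredSum, integral_sub (hint _) (hint θ₀)]
  fun_prop

lemma measure_exists_mem_closedBall_lt_centeredSum_le [SecondCountableTopology E]
    (hx : AEStronglyMeasurable x μ) (hxR : ∀ᵐ d ∂μ, ‖x d‖ ≤ R)
    (hf : ∀ θ θ' d, |f θ d - f θ' d| ≤ |inner ℝ (θ - θ') (x d)|)
    (hint : ∀ θ, Integrable (f θ) μ) (θ₀ : E) (ρ : ℝ) (n : ℕ) {c : ℝ} (hc : 0 ≤ c) :
    Measure.pi (fun _ : Fin n => μ)
        {D | ∃ θ ∈ Metric.closedBall θ₀ ρ, c < centeredSum μ (fun d => f θ d - f θ₀ d) D}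
      ≤ ENNReal.ofReal (2 * Real.exp (-(c ^ 2 / (8 * n * (ρ * R) ^ 2)))) := by
  obtain ⟨s, hs, hdense⟩ := TopologicalSpace.exists_countable_dense (Metric.closedBall θ₀ ρ)
  have : Countable s := hs
  refine (measure_mono ?_).trans (measure_exists_lt_centeredSum_le hx hxR
    (w := fun θ : s => (θ : E) - θ₀) (fun θ => mem_closedBall_iff_norm.1 θ.1.2)
    (h := fun (θ : s) d => f θ d - f θ₀ d) (fun θ => (hint θ).sub (hint θ₀))
    (fun θ d => hf θ θ₀ d) (fun θ θ' d => by simpa using hf θ θ' d) n hc)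
  rintro D ⟨θ, hθ, hlt⟩
  have hopen : IsOpen {θ : Metric.closedBall θ₀ ρ |
      c < centeredSum μ (fun d => f θ d - f θ₀ d) D} :=
    isOpen_lt continuous_const
      ((continuous_centeredSum_sub hxR hf hint θ₀ D).comp continuous_subtype_val)
  obtain ⟨θ', hθ', hs'⟩ := hdense.inter_open_nonempty _ hopen ⟨⟨θ, hθ⟩, hlt⟩
  exact ⟨⟨θ', hs'⟩, hθ'⟩

lemma exists_measurableSet_forall_centeredSum_le [SecondCountableTopology E]
    (hx : AEStronglyMeasurable x μ) (hR : 0 < R) (hxR : ∀ᵐ d ∂μ, ‖x d‖ ≤ R)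
    (hf : ∀ θ θ' d, |f θ d - f θ' d| ≤ |inner ℝ (θ - θ') (x d)|)
    (hint : ∀ θ, Integrable (f θ) μ) (θ₀ : E) {ρ : ℝ} (hρ : 0 ≤ ρ) {n : ℕ} (hn : 0 < n) {α : ℝ}
    (hα : 0 < α) (hα₁ : α ≤ 1) :
    ∃ S : Set (Fin n → X), MeasurableSet S ∧
      ENNReal.ofReal (1 - α) ≤ Measure.pi (fun _ : Fin n => μ) S ∧
      ∀ D ∈ S, ∀ θ ∈ Metric.closedBall θ₀ ρ,
        centeredSum μ (fun d => f θ d - f θ₀ d) D ≤ ρ * R * √(8 * n * Real.log (2 / α)) := by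
  set P := Measure.pi fun _ : Fin n => μ
  rcases hρ.eq_or_lt with rfl | hρ
  · refine ⟨Set.univ, .univ, by simp [P, hα.le], fun D _ θ hθ => ?_⟩
    obtain rfl : θ = θ₀ := by simpa using hθ
    simp [centeredSum]
  set c := ρ * R * √(8 * n * Real.log (2 / α)) with hc
  set bad := {D : Fin n → X | ∃ θ ∈ Metric.closedBall θ₀ ρ,
    c < centeredSum μ (fun d => f θ d - f θ₀ d) D}
  have hlog : 0 ≤ Real.log (2 / α) := Real.log_nonneg (by rw [le_div_iff₀ hα]; linarith)
  have hexp : 2 * Real.exp (-(c ^ 2 / (8 * n * (ρ * R) ^ 2))) = α := by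
    have : c ^ 2 / (8 * n * (ρ * R) ^ 2) = Real.log (2 / α) := by
      rw [hc, mul_pow, Real.sq_sqrt (by positivity)]
      field_simp
    rw [this, Real.exp_neg, Real.exp_log (by positivity)]
    field_simp
  have hbad : P bad ≤ ENNReal.ofReal α := hexp ▸
    measure_exists_mem_closedBall_lt_centeredSum_le hx hxR hf hint θ₀ ρ n (by positivity)
  refine ⟨(toMeasurable P bad)ᶜ, (measurableSet_toMeasurable _ _).compl, ?_, fun D hD θ hθ => ?_⟩
  · rw [prob_compl_eq_one_sub (measurableSet_toMeasurable _ _), measure_toMeasurable,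
      ENNReal.ofReal_sub _ hα.le, ENNReal.ofReal_one]
    gcongr
  · exact not_lt.1 fun hlt => hD (subset_toMeasurable _ _ ⟨θ, hθ, hlt⟩)

end UniformDeviation


section Lovasz

lemma mul_sub_le_sum_mul_sub {n : ℕ} {W : Fin n → ℝ} (hW : Antitone W) {T : ℕ → ℝ}
    (hT : ∀ m, T 0 ≤ T m) {c : ℝ} (hc : ∀ k, c ≤ W k) :
    c * (T n - T 0) ≤ ∑ k : Fin n, W k * (T (k + 1) - T k) := by
  induction n generalizing c with
  | zero => simp
  | succ n ih =>
    have hinit := ih (hW.comp_monotone Fin.strictMono_castSucc.monotone)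
      fun k => hW (Fin.le_last k.castSucc)
    simp only [Function.comp_apply] at hinit
    simp only [Fin.sum_univ_castSucc, Fin.val_castSucc, Fin.val_last]
    linarith [mul_le_mul_of_nonneg_right (hc (Fin.last n)) (sub_nonneg.2 (hT (n + 1)))]

variable {p : ℕ} {F : Finset (Fin p) → ℝ}

lemma IsSubmodular.sub_le_inter_sub (hsub : IsSubmodular F) {A : Finset (Fin p)} {i : Fin p}
    (hi : i ∈ A) (S : Finset (Fin p)) :
    F (insert i S) - F S ≤ F (A ∩ insert i S) - F (A ∩ S) := by
  have h := hsub (A ∩ insert i S) S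
  have h_union : A ∩ insert i S ∪ S = insert i S := by grind
  have h_inter : A ∩ insert i S ∩ S = A ∩ S := by grind
  rw [h_union, h_inter] at h
  linarith

/-- The set `{τ 0, …, τ (m - 1)}` of the first `m` elements in the ordering `τ`. -/
def prefixImage (τ : Equiv.Perm (Fin p)) (m : ℕ) : Finset (Fin p) :=
  Finset.univ.filter fun i => (τ.symm i).val < m

lemma mem_prefixImage {τ : Equiv.Perm (Fin p)} {m : ℕ} {i : Fin p} :
    i ∈ prefixImage τ m ↔ (τ.symm i).val < m := by simp [prefixImage]

lemma prefixImage_zero (τ : Equiv.Perm (Fin p)) : prefixImage τ 0 = ∅ := by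
  ext i; simp [mem_prefixImage]

lemma prefixImage_eq_univ (τ : Equiv.Perm (Fin p)) : prefixImage τ p = Finset.univ := by
  ext i; simp [mem_prefixImage]

lemma prefixImage_succ (τ : Equiv.Perm (Fin p)) (k : Fin p) :
    prefixImage τ (k + 1) = insert (τ k) (prefixImage τ k) := by
  ext i
  rw [Finset.mem_insert, mem_prefixImage, mem_prefixImage, Nat.lt_succ_iff_lt_or_eq, or_comm,
    ← Equiv.symm_apply_eq, Fin.ext_iff]

lemma apply_notMem_prefixImage (τ : Equiv.Perm (Fin p)) (k : Fin p) :
    τ k ∉ prefixImage τ k := by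
  simp [mem_prefixImage]

lemma image_Iic_eq_prefixImage (τ : Equiv.Perm (Fin p)) (k : Fin p) :
    (Finset.Iic k).image τ = prefixImage τ (k + 1) := by
  ext i
  simp only [Finset.mem_image, Finset.mem_Iic, mem_prefixImage, Nat.lt_succ_iff, ← Fin.le_def]
  exact ⟨fun ⟨j, hj, e⟩ => by simpa [← e] using hj, fun h => ⟨_, h, by simp⟩⟩

lemma image_Iio_eq_prefixImage (τ : Equiv.Perm (Fin p)) (k : Fin p) :
    (Finset.Iio k).image τ = prefixImage τ k := by
  ext i
  simp only [Finset.mem_image, Finset.mem_Iio, mem_prefixImage, ← Fin.lt_def]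
  exact ⟨fun ⟨j, hj, e⟩ => by simpa [← e] using hj, fun h => ⟨_, h, by simp⟩⟩

/-- The gain of adding `i` to the elements that precede it in the ordering `τ`. These gains form
the vertex of the submodular polyhedron which the greedy algorithm visits along `τ`. -/
noncomputable def marginalGain (F : Finset (Fin p) → ℝ) (τ : Equiv.Perm (Fin p)) (i : Fin p) : ℝ :=
  F (prefixImage τ ((τ.symm i).val + 1)) - F (prefixImage τ (τ.symm i))

lemma marginalGain_apply (F : Finset (Fin p) → ℝ) (τ : Equiv.Perm (Fin p)) (k : Fin p) :
    marginalGain F τ (τ k) = F (prefixImage τ (k + 1)) - F (prefixImage τ k) := by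
  simp [marginalGain]

lemma marginalGain_nonneg (hmono : Monotone F) (τ : Equiv.Perm (Fin p)) (i : Fin p) :
    0 ≤ marginalGain F τ i :=
  sub_nonneg.2 <| hmono fun _ hj =>
    mem_prefixImage.2 ((mem_prefixImage.1 hj).trans (Nat.lt_succ_self _))

lemma sum_marginalGain_le (hsub : IsSubmodular F) (h₀ : F ∅ = 0) (τ : Equiv.Perm (Fin p))
    (A : Finset (Fin p)) : ∑ i ∈ A, marginalGain F τ i ≤ F A := by
  have hgain : ∀ k : Fin p, (if τ k ∈ A then marginalGain F τ (τ k) else 0)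
      ≤ F (A ∩ prefixImage τ (k + 1)) - F (A ∩ prefixImage τ k) := by
    intro k
    rw [marginalGain_apply, prefixImage_succ]
    split_ifs with hk
    · exact hsub.sub_le_inter_sub hk _
    · rw [Finset.inter_insert_of_notMem hk, sub_self]
  calc ∑ i ∈ A, marginalGain F τ i
      = ∑ k, (if τ k ∈ A then marginalGain F τ (τ k) else 0) := by
        rw [Equiv.sum_comp τ fun i => if i ∈ A then marginalGain F τ i else 0,
          Finset.sum_ite_mem, Finset.univ_inter]
    _ ≤ ∑ k : Fin p, (F (A ∩ prefixImage τ (k + 1)) - F (A ∩ prefixImage τ k)) :=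
        Finset.sum_le_sum fun k _ => hgain k
    _ = F A := by
        rw [Fin.sum_univ_eq_sum_range
          (fun m => F (A ∩ prefixImage τ (m + 1)) - F (A ∩ prefixImage τ m)),
          Finset.sum_range_sub (fun m => F (A ∩ prefixImage τ m)), prefixImage_zero,
          prefixImage_eq_univ, Finset.inter_univ, Finset.inter_empty, h₀, sub_zero]

/-- The permutation that sorts the entries of `θ` by decreasing absolute value. -/
noncomputable def absSort (θ : EuclideanSpace ℝ (Fin p)) : Equiv.Perm (Fin p) :=
  Tuple.sort fun i => -|θ i|

lemma antitone_abs_absSort (θ : EuclideanSpace ℝ (Fin p)) :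
    Antitone fun k => |θ (absSort θ k)| := fun _ _ hij =>
  neg_le_neg_iff.1 (Tuple.monotone_sort (fun i => -|θ i|) hij)

lemma omegaInf_eq_sum_mul_marginalGain (F : Finset (Fin p) → ℝ) (θ : EuclideanSpace ℝ (Fin p)) :
    omegaInf F θ = ∑ i, |θ i| * marginalGain F (absSort θ) i := by
  rw [← Equiv.sum_comp (absSort θ)]
  simp only [omegaInf, lovaszExtension, image_Iic_eq_prefixImage, image_Iio_eq_prefixImage,
    marginalGain_apply]
  rfl

lemma sum_abs_mul_abs_le_omegaInf (h₀ : F ∅ = 0) (θ : EuclideanSpace ℝ (Fin p))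
    {s : EuclideanSpace ℝ (Fin p)} (hs : s ∈ symPolyhedron F) :
    ∑ i, |θ i| * |s i| ≤ omegaInf F θ := by
  set τ := absSort θ
  set T : ℕ → ℝ := fun m => F (prefixImage τ m) - ∑ i ∈ prefixImage τ m, |s i|
  have hT₀ : T 0 = 0 := by simp [T, prefixImage_zero, h₀]
  have hslack : ∀ k : Fin p, T (k + 1) - T k = marginalGain F τ (τ k) - |s (τ k)| := fun k => by
    simp only [T]
    rw [marginalGain_apply, prefixImage_succ,
      Finset.sum_insert (apply_notMem_prefixImage τ k)]
    ring
  have h := mul_sub_le_sum_mul_sub (antitone_abs_absSort θ) (T := T) (c := 0)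
    (fun m => hT₀ ▸ sub_nonneg.2 (hs _)) fun k => abs_nonneg _
  simp only [zero_mul, ← show τ = absSort θ from rfl, hslack, mul_sub,
    Finset.sum_sub_distrib] at h
  rw [Equiv.sum_comp τ fun i => |θ i| * marginalGain F τ i,
    Equiv.sum_comp τ fun i => |θ i| * |s i|, ← omegaInf_eq_sum_mul_marginalGain] at h
  linarith

lemma inner_le_omegaInf (h₀ : F ∅ = 0) (θ : EuclideanSpace ℝ (Fin p))
    {s : EuclideanSpace ℝ (Fin p)} (hs : s ∈ symPolyhedron F) : inner ℝ θ s ≤ omegaInf F θ := by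
  refine le_trans ?_ (sum_abs_mul_abs_le_omegaInf h₀ θ hs)
  rw [PiLp.inner_apply]
  refine Finset.sum_le_sum fun i _ => ?_
  rw [← abs_mul, mul_comm (θ i)]
  exact le_abs_self _

lemma exists_inner_eq_omegaInf (hmono : Monotone F) (hsub : IsSubmodular F) (h₀ : F ∅ = 0)
    (θ : EuclideanSpace ℝ (Fin p)) : ∃ s ∈ symPolyhedron F, inner ℝ θ s = omegaInf F θ := by
  set τ := absSort θ
  refine ⟨WithLp.toLp 2 fun i => (if 0 ≤ θ i then 1 else -1) * marginalGain F τ i, fun A => ?_, ?_⟩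
  · refine le_of_eq_of_le (Finset.sum_congr rfl fun i _ => ?_) (sum_marginalGain_le hsub h₀ τ A)
    rw [abs_mul, abs_of_nonneg (marginalGain_nonneg hmono τ i)]
    split_ifs <;> simp
  · rw [omegaInf_eq_sum_mul_marginalGain, PiLp.inner_apply]
    refine Finset.sum_congr rfl fun i _ => ?_
    simp only [RCLike.inner_apply, conj_trivial]
    split_ifs with hi
    · rw [abs_of_nonneg hi]
      ring
    · rw [abs_of_neg (not_le.1 hi)]
      ring

lemma zero_mem_symPolyhedron (hmono : Monotone F) (h₀ : F ∅ = 0) :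
    (0 : EuclideanSpace ℝ (Fin p)) ∈ symPolyhedron F := fun A => by
  simpa [h₀] using hmono (Finset.empty_subset A)

lemma omegaInf_eq_iSup (hmono : Monotone F) (hsub : IsSubmodular F) (h₀ : F ∅ = 0)
    (θ : EuclideanSpace ℝ (Fin p)) :
    omegaInf F θ = ⨆ w : symPolyhedron F, inner ℝ θ (w : EuclideanSpace ℝ (Fin p)) := by
  obtain ⟨s, hs, hθs⟩ := exists_inner_eq_omegaInf hmono hsub h₀ θ
  have hgreatest : IsGreatest
      (Set.range fun w : symPolyhedron F => inner ℝ θ (w : EuclideanSpace ℝ (Fin p)))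
      (omegaInf F θ) :=
    ⟨⟨⟨s, hs⟩, hθs⟩, Set.forall_mem_range.2 fun w => inner_le_omegaInf h₀ θ w.2⟩
  exact hgreatest.csSup_eq.symm

lemma omegaInf_nonneg (hmono : Monotone F) (h₀ : F ∅ = 0) (θ : EuclideanSpace ℝ (Fin p)) :
    0 ≤ omegaInf F θ := by
  simpa using inner_le_omegaInf h₀ θ (zero_mem_symPolyhedron hmono h₀)

lemma omegaInf_add_le (hmono : Monotone F) (hsub : IsSubmodular F) (h₀ : F ∅ = 0)
    (θ θ' : EuclideanSpace ℝ (Fin p)) :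
    omegaInf F (θ + θ') ≤ omegaInf F θ + omegaInf F θ' := by
  obtain ⟨s, hs, hθs⟩ := exists_inner_eq_omegaInf hmono hsub h₀ (θ + θ')
  rw [← hθs, inner_add_left]
  exact add_le_add (inner_le_omegaInf h₀ _ hs) (inner_le_omegaInf h₀ _ hs)

lemma omegaInf_smul_le (hmono : Monotone F) (hsub : IsSubmodular F) (h₀ : F ∅ = 0)
    {c : ℝ} (hc : 0 ≤ c) (θ : EuclideanSpace ℝ (Fin p)) :
    omegaInf F (c • θ) ≤ c * omegaInf F θ := by
  obtain ⟨s, hs, hθs⟩ := exists_inner_eq_omegaInf hmono hsub h₀ (c • θ)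
  rw [← hθs, real_inner_smul_left]
  exact mul_le_mul_of_nonneg_left (inner_le_omegaInf h₀ _ hs) hc

lemma omegaInf_le_mul_norm (hmono : Monotone F) (hsub : IsSubmodular F) (h₀ : F ∅ = 0)
    (θ : EuclideanSpace ℝ (Fin p)) : omegaInf F θ ≤ F Finset.univ * ‖θ‖ :=
  calc omegaInf F θ = ∑ i, |θ i| * marginalGain F (absSort θ) i :=
        omegaInf_eq_sum_mul_marginalGain F θ
    _ ≤ ∑ i, ‖θ‖ * marginalGain F (absSort θ) i := by
        gcongr with i
        · exact marginalGain_nonneg hmono _ i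
        · exact PiLp.norm_apply_le θ i
    _ = ‖θ‖ * ∑ i, marginalGain F (absSort θ) i := (Finset.mul_sum ..).symm
    _ ≤ ‖θ‖ * F Finset.univ := by
        gcongr
        exact sum_marginalGain_le hsub h₀ _ _
    _ = F Finset.univ * ‖θ‖ := mul_comm _ _

lemma lipschitzWith_omegaInf (hmono : Monotone F) (hsub : IsSubmodular F) (h₀ : F ∅ = 0) :
    LipschitzWith (F Finset.univ).toNNReal (omegaInf F) :=
  LipschitzWith.of_le_add_mul' _ fun θ θ' =>
    calc omegaInf F θ = omegaInf F (θ' + (θ - θ')) := by rw [add_sub_cancel]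
      _ ≤ omegaInf F θ' + omegaInf F (θ - θ') := omegaInf_add_le hmono hsub h₀ _ _
      _ ≤ omegaInf F θ' + F Finset.univ * dist θ θ' := by
          rw [dist_eq_norm]
          gcongr
          exact omegaInf_le_mul_norm hmono hsub h₀ _

lemma abs_mul_singleton_le_omegaInf (hmono : Monotone F) (h₀ : F ∅ = 0)
    (θ : EuclideanSpace ℝ (Fin p)) (i : Fin p) : |θ i| * F {i} ≤ omegaInf F θ := by
  have hF : ∀ A, 0 ≤ F A := fun A => h₀ ▸ hmono (Finset.empty_subset A)
  have habs : ∀ j, |EuclideanSpace.single i (F {i}) j| = if j = i then F {i} else 0 := fun j => by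
    rw [PiLp.single_apply]
    split_ifs
    · exact abs_of_nonneg (hF _)
    · exact abs_zero
  have hs : EuclideanSpace.single i (F {i}) ∈ symPolyhedron F := fun A => by
    simp only [habs, Finset.sum_ite_eq']
    split_ifs with hi
    · exact hmono (Finset.singleton_subset_iff.2 hi)
    · exact hF A
  have h := sum_abs_mul_abs_le_omegaInf h₀ θ hs
  simpa only [habs, mul_ite, mul_zero, Finset.sum_ite_eq', Finset.mem_univ, if_true] using h

end Lovasz


section GaussianNoise

lemma integrable_of_lipschitzWith {E : Type*} [NormedAddCommGroup E] [SecondCountableTopology E]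
    [MeasurableSpace E] [OpensMeasurableSpace E] {ν : Measure E} [IsFiniteMeasure ν]
    (hν : Integrable id ν) {K : NNReal} {g : E → ℝ} (hg : LipschitzWith K g) : Integrable g ν := by
  refine ((integrable_const |g 0|).add (hν.norm.const_mul K)).mono'
    hg.continuous.aestronglyMeasurable (ae_of_all _ fun b => ?_)
  have h := hg.norm_sub_le b 0
  rw [sub_zero] at h
  exact (norm_le_norm_add_norm_sub' (g b) (g 0)).trans (add_le_add_right h _)

lemma integrable_add_of_lipschitzWith {E : Type*} [NormedAddCommGroup E]
    [SecondCountableTopology E] [MeasurableSpace E] [OpensMeasurableSpace E] {ν : Measure E}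
    [IsFiniteMeasure ν] (hν : Integrable id ν) {K : NNReal} {g : E → ℝ} (hg : LipschitzWith K g)
    (θ : E) : Integrable (fun b => g (θ + b)) ν :=
  integrable_of_lipschitzWith hν (hg.comp (isometry_add_left θ).lipschitz)

section Averaging

variable {X E : Type*} [MeasurableSpace X] {μ : Measure X} [IsProbabilityMeasure μ]
  [NormedAddCommGroup E] [InnerProductSpace ℝ E] [MeasurableSpace E] {ν : Measure E}
  {x : X → E} {R : ℝ}

lemma integrable_abs_inner_prod (hν : Integrable id ν) (hx : AEStronglyMeasurable x μ)
    (hxR : ∀ᵐ d ∂μ, ‖x d‖ ≤ R) :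
    Integrable (fun z : E × X => |inner ℝ z.1 (x z.2)|) (ν.prod μ) := by
  have hinner : AEStronglyMeasurable (fun z : E × X => inner ℝ z.1 (x z.2)) (ν.prod μ) :=
    hν.aestronglyMeasurable.comp_fst.inner hx.comp_snd
  refine ((hν.norm.mul_const R).comp_fst μ).mono' hinner.norm ?_
  filter_upwards [Measure.quasiMeasurePreserving_snd.ae hxR] with z hz
  rw [Real.norm_eq_abs, abs_abs]
  exact (abs_real_inner_le_norm _ _).trans (mul_le_mul_of_nonneg_left hz (norm_nonneg _))

lemma integral_integral_add_le [SecondCountableTopology E] [BorelSpace E] [IsProbabilityMeasure ν]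
    (hν : Integrable id ν) {s : ℝ} (hs : 0 ≤ s)
    (hmoment : ∀ v : E, ∫ b, |inner ℝ b v| ∂ν ≤ s * ‖v‖) (hx : AEStronglyMeasurable x μ)
    (hxR : ∀ᵐ d ∂μ, ‖x d‖ ≤ R) {f : E → X → ℝ}
    (hf : ∀ θ θ' d, |f θ d - f θ' d| ≤ |inner ℝ (θ - θ') (x d)|)
    (hint : ∀ θ, Integrable (f θ) μ) (θ : E) :
    ∫ b, ∫ d, f (θ + b) d ∂μ ∂ν ≤ (∫ d, f θ d ∂μ) + s * R := by
  have hprod := integrable_abs_inner_prod hν hx hxR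
  have hshift : Integrable (fun b => ∫ d, f (θ + b) d ∂μ) ν :=
    integrable_add_of_lipschitzWith hν (lipschitzWith_integral_of_abs_sub_le_inner hxR hf hint) θ
  have hswap : ∫ b, ∫ d, |inner ℝ b (x d)| ∂μ ∂ν ≤ s * R := by
    rw [integral_integral_swap hprod]
    refine (integral_mono_ae hprod.integral_prod_right (integrable_const (s * R)) ?_).trans
      (by simp)
    filter_upwards [hxR] with d hd
    exact (hmoment (x d)).trans (by gcongr)
  calc ∫ b, ∫ d, f (θ + b) d ∂μ ∂ν
      ≤ ∫ b, ((∫ d, f θ d ∂μ) + ∫ d, |inner ℝ b (x d)| ∂μ) ∂ν := by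
        refine integral_mono_ae hshift ((integrable_const _).add hprod.integral_prod_left) ?_
        filter_upwards [hprod.prod_right_ae] with b hb
        rw [← integral_add (hint θ) hb]
        refine integral_mono (hint _) ((hint θ).add hb) fun d => ?_
        have h := (le_abs_self _).trans (hf (θ + b) θ d)
        rw [add_sub_cancel_left] at h
        exact sub_le_iff_le_add'.1 h
    _ = (∫ d, f θ d ∂μ) + ∫ b, ∫ d, |inner ℝ b (x d)| ∂μ ∂ν := by
        rw [integral_add (integrable_const _) hprod.integral_prod_left, integral_const,
          probReal_univ, one_smul]
    _ ≤ (∫ d, f θ d ∂μ) + s * R := by gcongr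

end Averaging

section StdGaussian

variable {E : Type*} [NormedAddCommGroup E] [InnerProductSpace ℝ E] [FiniteDimensional ℝ E]
  [MeasurableSpace E] [BorelSpace E]

lemma memLp_inner_stdGaussian (x : E) : MemLp (fun b => inner ℝ b x) 2 (stdGaussian E) := by
  simpa [real_inner_comm] using
    IsGaussian.memLp_dual (stdGaussian E) (innerSL ℝ x) 2 (by simp)

lemma integral_inner_sq_stdGaussian (x : E) :
    ∫ b, inner ℝ b x ^ 2 ∂stdGaussian E = ‖x‖ ^ 2 := by
  have h := variance_dual_stdGaussian (E := E) (innerSL ℝ x)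
  rw [variance_of_integral_eq_zero (innerSL ℝ x).continuous.aemeasurable
    (integral_strongDual_stdGaussian _), innerSL_apply_norm] at h
  simpa [real_inner_comm] using h

lemma integral_abs_inner_stdGaussian_le (x : E) : ∫ b, |inner ℝ b x| ∂stdGaussian E ≤ ‖x‖ := by
  have h := variance_nonneg (fun b => |inner ℝ b x|) (stdGaussian E)
  rw [variance_eq_sub (X := fun b => |inner ℝ b x|) (memLp_inner_stdGaussian x).abs] at h
  simp only [Pi.pow_apply, sq_abs, integral_inner_sq_stdGaussian] at h
  exact le_of_sq_le_sq (sub_nonneg.1 h) (norm_nonneg x)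

end StdGaussian

section IsotropicGaussian

variable {p : ℕ} {F : Finset (Fin p) → ℝ} {σ : ℝ}

lemma gaussianWidth_symPolyhedron (hmono : Monotone F) (hsub : IsSubmodular F) (h₀ : F ∅ = 0) :
    gaussianWidth (symPolyhedron F)
      = ∫ b, omegaInf F b ∂stdGaussian (EuclideanSpace ℝ (Fin p)) := by
  simp only [gaussianWidth, omegaInf_eq_iSup hmono hsub h₀]

lemma integrable_omegaInf_stdGaussian (hmono : Monotone F) (hsub : IsSubmodular F)
    (h₀ : F ∅ = 0) : Integrable (omegaInf F) (stdGaussian (EuclideanSpace ℝ (Fin p))) :=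
  integrable_of_lipschitzWith IsGaussian.integrable_id (lipschitzWith_omegaInf hmono hsub h₀)

lemma gaussianWidth_pos (hmono : Monotone F) (hsub : IsSubmodular F) (h₀ : F ∅ = 0)
    (hF : ∃ i, 0 < F {i}) : 0 < gaussianWidth (symPolyhedron F) := by
  obtain ⟨i, hi⟩ := hF
  rw [gaussianWidth_symPolyhedron hmono hsub h₀]
  refine (integral_nonneg (omegaInf_nonneg hmono h₀)).lt_of_ne fun hzero => ?_
  have homega := (integral_eq_zero_iff_of_nonneg (omegaInf_nonneg hmono h₀)
    (integrable_omegaInf_stdGaussian hmono hsub h₀)).1 hzero.symm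
  have hcoord : (fun b : EuclideanSpace ℝ (Fin p) => inner ℝ b (EuclideanSpace.single i 1) ^ 2)
      =ᵐ[stdGaussian (EuclideanSpace ℝ (Fin p))] fun _ => (0 : ℝ) := by
    filter_upwards [homega] with b hb
    have hle := hb ▸ abs_mul_singleton_le_omegaInf hmono h₀ b i
    have hbi : |b i| ≤ 0 := nonpos_of_mul_nonpos_left hle hi
    simp [EuclideanSpace.inner_single_right, abs_nonpos_iff.1 hbi]
  have hmoment := integral_inner_sq_stdGaussian (EuclideanSpace.single i (1 : ℝ))
  rw [integral_congr_ae hcoord] at hmoment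
  simp at hmoment

instance isGaussian_isotropicGaussian (p : ℕ) (σ : ℝ) : IsGaussian (isotropicGaussian p σ) :=
  inferInstanceAs <| IsGaussian <| (stdGaussian (EuclideanSpace ℝ (Fin p))).map
    (σ • ContinuousLinearMap.id ℝ (EuclideanSpace ℝ (Fin p)))

lemma integral_isotropicGaussian {g : EuclideanSpace ℝ (Fin p) → ℝ} (hg : Continuous g) (σ : ℝ) :
    ∫ b, g b ∂isotropicGaussian p σ
      = ∫ b, g (σ • b) ∂stdGaussian (EuclideanSpace ℝ (Fin p)) :=
  integral_map (by fun_prop) hg.aestronglyMeasurable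

lemma integral_abs_inner_isotropicGaussian_le (hσ : 0 ≤ σ) (v : EuclideanSpace ℝ (Fin p)) :
    ∫ b, |inner ℝ b v| ∂isotropicGaussian p σ ≤ σ * ‖v‖ := by
  rw [integral_isotropicGaussian (by fun_prop)]
  simp only [real_inner_smul_left, abs_mul, abs_of_nonneg hσ]
  rw [integral_const_mul]
  exact mul_le_mul_of_nonneg_left (integral_abs_inner_stdGaussian_le v) hσ

lemma integrable_omegaInf_add (hmono : Monotone F) (hsub : IsSubmodular F) (h₀ : F ∅ = 0) (σ : ℝ)
    (θ : EuclideanSpace ℝ (Fin p)) :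
    Integrable (fun b => omegaInf F (θ + b)) (isotropicGaussian p σ) :=
  integrable_add_of_lipschitzWith IsGaussian.integrable_id (lipschitzWith_omegaInf hmono hsub h₀) θ

lemma integral_omegaInf_add_le (hmono : Monotone F) (hsub : IsSubmodular F) (h₀ : F ∅ = 0)
    (hσ : 0 ≤ σ) (θ : EuclideanSpace ℝ (Fin p)) :
    ∫ b, omegaInf F (θ + b) ∂isotropicGaussian p σ
      ≤ omegaInf F θ + σ * gaussianWidth (symPolyhedron F) := by
  have hint := integrable_omegaInf_stdGaussian hmono hsub h₀
  have hlip := lipschitzWith_omegaInf hmono hsub h₀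
  calc ∫ b, omegaInf F (θ + b) ∂isotropicGaussian p σ
      = ∫ b, omegaInf F (θ + σ • b) ∂stdGaussian (EuclideanSpace ℝ (Fin p)) :=
        integral_isotropicGaussian (hlip.continuous.comp (continuous_const_add θ)) σ
    _ ≤ ∫ b, (omegaInf F θ + σ * omegaInf F b) ∂stdGaussian (EuclideanSpace ℝ (Fin p)) := by
        refine integral_mono_of_nonneg (ae_of_all _ fun b => omegaInf_nonneg hmono h₀ _)
          ((integrable_const _).add (hint.const_mul σ)) (ae_of_all _ fun b => ?_)
        exact (omegaInf_add_le hmono hsub h₀ _ _).trans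
          (add_le_add_right (omegaInf_smul_le hmono hsub h₀ hσ b) _)
    _ = omegaInf F θ + σ * gaussianWidth (symPolyhedron F) := by
        rw [integral_add (integrable_const _) (hint.const_mul σ), integral_const, probReal_univ,
          one_smul, integral_const_mul, gaussianWidth_symPolyhedron hmono hsub h₀]

end IsotropicGaussian

end GaussianNoise


section Risk

variable {p n : ℕ} {F : Finset (Fin p) → ℝ} {ℓ : ℝ → ℝ → ℝ} {L R₂ lam σ : ℝ}
  {Dist : Measure (DataPoint p)}

lemma abs_glmLoss_sub_le (hℓ : ∀ y u v, |ℓ u y - ℓ v y| ≤ L * |u - v|)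
    (θ θ' : EuclideanSpace ℝ (Fin p)) (d : DataPoint p) :
    |glmLoss ℓ θ d - glmLoss ℓ θ' d| ≤ |inner ℝ (θ - θ') (L • d.1)| := by
  rw [real_inner_smul_right, abs_mul, inner_sub_left]
  exact (hℓ _ _ _).trans (mul_le_mul_of_nonneg_right (le_abs_self L) (abs_nonneg _))

lemma ae_norm_smul_fst_le (hL : 0 ≤ L) (hR : ∀ᵐ d ∂Dist, ‖d.1‖ ≤ R₂) :
    ∀ᵐ d ∂Dist, ‖L • d.1‖ ≤ L * R₂ := by
  filter_upwards [hR] with d hd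
  rw [norm_smul, Real.norm_of_nonneg hL]
  gcongr

variable [IsProbabilityMeasure Dist]

lemma trueRisk_eq (hint : ∀ θ, Integrable (glmLoss ℓ θ) Dist)
    (n : ℕ) (F : Finset (Fin p) → ℝ) (lam : ℝ) (θ : EuclideanSpace ℝ (Fin p)) :
    trueRisk n ℓ F lam Dist θ = (∫ d, glmLoss ℓ θ d ∂Dist) + lam / n * omegaInf F θ := by
  rw [trueRisk, integral_add (hint θ) (integrable_const _), integral_const, probReal_univ,
    one_smul]

lemma trueRisk_sub_le_of_empRisk_le (hint : ∀ θ, Integrable (glmLoss ℓ θ) Dist) (hn : 0 < n)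
    {D : Fin n → DataPoint p} {θ θ₀ : EuclideanSpace ℝ (Fin p)}
    (h : empRisk ℓ F lam D θ ≤ empRisk ℓ F lam D θ₀) :
    trueRisk n ℓ F lam Dist θ - trueRisk n ℓ F lam Dist θ₀
      ≤ centeredSum Dist (fun d => glmLoss ℓ θ d - glmLoss ℓ θ₀ d) D / n := by
  have hn' : (n : ℝ) ≠ 0 := by positivity
  have hsum : centeredSum Dist (fun d => glmLoss ℓ θ d - glmLoss ℓ θ₀ d) D / n
      = (∫ d, glmLoss ℓ θ d ∂Dist) - (∫ d, glmLoss ℓ θ₀ d ∂Dist)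
        - ((1 / (n : ℝ)) * ∑ i, glmLoss ℓ θ (D i) - (1 / (n : ℝ)) * ∑ i, glmLoss ℓ θ₀ (D i)) := by
    simp only [centeredSum, integral_sub (hint θ) (hint θ₀), Finset.sum_sub_distrib,
      Finset.sum_const, Finset.card_univ, Fintype.card_fin, nsmul_eq_mul]
    field_simp
  rw [hsum, trueRisk_eq hint, trueRisk_eq hint]
  simp only [empRisk] at h
  linarith

lemma exists_measurableSet_forall_trueRisk_sub_le (hL : 0 < L) (hR₂ : 0 < R₂)
    (hℓ : ∀ y u v, |ℓ u y - ℓ v y| ≤ L * |u - v|) (hR : ∀ᵐ d ∂Dist, ‖d.1‖ ≤ R₂)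
    (hint : ∀ θ, Integrable (glmLoss ℓ θ) Dist) (hn : 0 < n) {α : ℝ} (hα : 0 < α) (hα₁ : α ≤ 1)
    (F : Finset (Fin p) → ℝ) (lam : ℝ) {B : ℝ} {θ₀ : EuclideanSpace ℝ (Fin p)}
    (hB : ‖θ₀‖ ≤ B) :
    ∃ S : Set (Fin n → DataPoint p), MeasurableSet S ∧
      ENNReal.ofReal (1 - α) ≤ Measure.pi (fun _ : Fin n => Dist) S ∧
      ∀ D ∈ S, ∀ θ, ‖θ‖ ≤ B → empRisk ℓ F lam D θ ≤ empRisk ℓ F lam D θ₀ →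
        trueRisk n ℓ F lam Dist θ - trueRisk n ℓ F lam Dist θ₀
          ≤ 6 * (L * R₂ * B * √(Real.log (2 / α)) / √n) := by
  have hB₀ : 0 ≤ B := (norm_nonneg _).trans hB
  obtain ⟨S, hS, hprob, hdev⟩ := exists_measurableSet_forall_centeredSum_le (x := fun d => L • d.1)
    (by fun_prop) (mul_pos hL hR₂) (ae_norm_smul_fst_le hL.le hR) (abs_glmLoss_sub_le hℓ) hint θ₀
    (mul_nonneg zero_le_two hB₀) hn hα hα₁
  refine ⟨S, hS, hprob, fun D hD θ hθ hemp => ?_⟩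
  have hball : θ ∈ Metric.closedBall θ₀ (2 * B) := by
    rw [mem_closedBall_iff_norm, two_mul]
    exact (norm_sub_le θ θ₀).trans (add_le_add hθ hB)
  have hsqrt : √(8 * n * Real.log (2 / α)) ≤ 3 * √n * √(Real.log (2 / α)) := by
    rw [mul_assoc, Real.sqrt_mul (by norm_num), Real.sqrt_mul (Nat.cast_nonneg n), mul_assoc]
    gcongr
    rw [Real.sqrt_le_left (by norm_num)]
    norm_num
  calc trueRisk n ℓ F lam Dist θ - trueRisk n ℓ F lam Dist θ₀
      ≤ centeredSum Dist (fun d => glmLoss ℓ θ d - glmLoss ℓ θ₀ d) D / n :=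
        trueRisk_sub_le_of_empRisk_le hint hn hemp
    _ ≤ 2 * B * (L * R₂) * √(8 * n * Real.log (2 / α)) / n := by
        gcongr
        exact hdev D hD θ hball
    _ ≤ 2 * B * (L * R₂) * (3 * √n * √(Real.log (2 / α))) / n := by gcongr
    _ = 6 * (L * R₂ * B * √(Real.log (2 / α)) * (√n / n)) := by ring
    _ = 6 * (L * R₂ * B * √(Real.log (2 / α)) / √n) := by
        rw [Real.sqrt_div_self, ← div_eq_mul_inv]

lemma integrable_integral_glmLoss_add (hL : 0 ≤ L) (hℓ : ∀ y u v, |ℓ u y - ℓ v y| ≤ L * |u - v|)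
    (hR : ∀ᵐ d ∂Dist, ‖d.1‖ ≤ R₂) (hint : ∀ θ, Integrable (glmLoss ℓ θ) Dist) (σ : ℝ)
    (θ : EuclideanSpace ℝ (Fin p)) :
    Integrable (fun b => ∫ d, glmLoss ℓ (θ + b) d ∂Dist) (isotropicGaussian p σ) :=
  integrable_add_of_lipschitzWith IsGaussian.integrable_id
    (lipschitzWith_integral_of_abs_sub_le_inner (ae_norm_smul_fst_le hL hR)
      (abs_glmLoss_sub_le hℓ) hint) θ

lemma integrable_trueRisk_add (hmono : Monotone F) (hsub : IsSubmodular F) (h₀ : F ∅ = 0)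
    (hL : 0 ≤ L) (hℓ : ∀ y u v, |ℓ u y - ℓ v y| ≤ L * |u - v|) (hR : ∀ᵐ d ∂Dist, ‖d.1‖ ≤ R₂)
    (hint : ∀ θ, Integrable (glmLoss ℓ θ) Dist) (n : ℕ) (lam σ : ℝ)
    (θ : EuclideanSpace ℝ (Fin p)) :
    Integrable (fun b => trueRisk n ℓ F lam Dist (θ + b)) (isotropicGaussian p σ) := by
  simp only [trueRisk_eq hint]
  exact (integrable_integral_glmLoss_add hL hℓ hR hint σ θ).add
    ((integrable_omegaInf_add hmono hsub h₀ σ θ).const_mul _)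

lemma integral_trueRisk_add_le (hmono : Monotone F) (hsub : IsSubmodular F) (h₀ : F ∅ = 0)
    (hL : 0 ≤ L) (hℓ : ∀ y u v, |ℓ u y - ℓ v y| ≤ L * |u - v|) (hR : ∀ᵐ d ∂Dist, ‖d.1‖ ≤ R₂)
    (hint : ∀ θ, Integrable (glmLoss ℓ θ) Dist) (n : ℕ) (hlam : 0 ≤ lam) (hσ : 0 ≤ σ)
    (θ : EuclideanSpace ℝ (Fin p)) :
    ∫ b, trueRisk n ℓ F lam Dist (θ + b) ∂isotropicGaussian p σ
      ≤ trueRisk n ℓ F lam Dist θ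
        + (σ * (L * R₂) + lam / n * (σ * gaussianWidth (symPolyhedron F))) := by
  have hx : AEStronglyMeasurable (fun d : DataPoint p => L • d.1) Dist := by fun_prop
  have hloss : ∫ b, ∫ d, glmLoss ℓ (θ + b) d ∂Dist ∂isotropicGaussian p σ
      ≤ (∫ d, glmLoss ℓ θ d ∂Dist) + σ * (L * R₂) :=
    integral_integral_add_le IsGaussian.integrable_id hσ
      (integral_abs_inner_isotropicGaussian_le hσ) hx (ae_norm_smul_fst_le hL hR)
      (abs_glmLoss_sub_le hℓ) hint θ
  have hreg := mul_le_mul_of_nonneg_left (integral_omegaInf_add_le hmono hsub h₀ hσ θ)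
    (div_nonneg hlam (Nat.cast_nonneg n))
  simp only [trueRisk_eq hint]
  rw [integral_add (integrable_integral_glmLoss_add hL hℓ hR hint σ θ)
    ((integrable_omegaInf_add hmono hsub h₀ σ θ).const_mul _), integral_const_mul]
  linarith

lemma noise_rate_le {ε G s : ℝ} (hL : 0 < L) (hR₂ : 0 < R₂) (hG : 0 < G) (hε : 0 < ε)
    (hs : 0 ≤ s) (hn : 0 < n) (hlam : lam = L * R₂ * √n / G) (hσ : σ = 4 * L * R₂ * s / (lam * ε)) :
    σ * (L * R₂) + lam / n * (σ * G) ≤ 8 * (L * R₂ * G * s / (ε * √n)) := by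
  have hn₁ : 1 ≤ √(n : ℝ) := Real.one_le_sqrt.2 (by exact_mod_cast hn)
  have hσ' : σ = 4 * G * s / (√n * ε) := by
    rw [hσ, hlam]
    field_simp
  have hloss : σ * (L * R₂) = 4 * (L * R₂ * G * s / (ε * √n)) := by
    rw [hσ']
    field_simp
  have hreg : lam / n * (σ * G) = 4 * (L * R₂ * G * s / (ε * √n)) / √n := by
    rw [hσ', hlam]
    field_simp
    rw [Real.sq_sqrt (Nat.cast_nonneg n)]
  have hdiv := div_le_self (a := 4 * (L * R₂ * G * s / (ε * √n))) (by positivity) hn₁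
  linarith

end Risk

end SparsePrivateERM

open SparsePrivateERM in
theorem theorem1_general {p n : ℕ} (hn : 0 < n) {F : Finset (Fin p) → ℝ} (hmono : Monotone F)
    (hsub : IsSubmodular F) (h₀ : F ∅ = 0) (hF : ∃ i, 0 < F {i}) {ℓ : ℝ → ℝ → ℝ} {L R₂ : ℝ}
    (hL : 0 < L) (hR₂ : 0 < R₂) (hℓ : ∀ y u v, |ℓ u y - ℓ v y| ≤ L * |u - v|)
    {Dist : Measure (DataPoint p)} [IsProbabilityMeasure Dist] (hR : ∀ᵐ d ∂Dist, ‖d.1‖ ≤ R₂)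
    (hint : ∀ θ, Integrable (glmLoss ℓ θ) Dist) {B ε δ α : ℝ} (hε : 0 < ε) (hδ : 0 < δ)
    (hδ₁ : δ ≤ 1) (hα : 0 < α) (hα₁ : α ≤ 1) {G lam σ : ℝ}
    (hG : G = gaussianWidth (symPolyhedron F)) (hlam : lam = L * R₂ * √n / G)
    (hσ : σ = 4 * L * R₂ * √(Real.log (1 / δ) + ε) / (lam * ε))
    {θ₀ : EuclideanSpace ℝ (Fin p)} (hB : ‖θ₀‖ ≤ B) :
    ∃ S : Set (Fin n → DataPoint p), MeasurableSet S ∧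
      ENNReal.ofReal (1 - α) ≤ Measure.pi (fun _ : Fin n => Dist) S ∧
      ∀ D ∈ S, ∀ θ, empRisk ℓ F lam D θ ≤ empRisk ℓ F lam D θ₀ → ‖θ‖ ≤ B →
        Integrable
          (fun b => trueRisk n ℓ F lam Dist (θ + b) - trueRisk n ℓ F lam Dist θ₀)
          (isotropicGaussian p σ) ∧
        ∫ b, (trueRisk n ℓ F lam Dist (θ + b) - trueRisk n ℓ F lam Dist θ₀)
            ∂(isotropicGaussian p σ)
          ≤ 8 * (1 + B * ε * √(Real.log (2 / α)) / (G * √(Real.log (1 / δ) + ε)))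
              * (L * R₂ * G * √(Real.log (1 / δ) + ε) / (ε * √n)) := by
  have hG₀ : 0 < G := hG ▸ gaussianWidth_pos hmono hsub h₀ hF
  have hlog : 0 ≤ Real.log (1 / δ) := Real.log_nonneg (one_le_one_div hδ hδ₁)
  set s := √(Real.log (1 / δ) + ε)
  have hs₀ : 0 < s := by positivity
  have hlam₀ : 0 < lam := by rw [hlam]; positivity
  have hσ₀ : 0 < σ := by rw [hσ]; positivity
  have hB₀ : 0 ≤ B := (norm_nonneg _).trans hB
  obtain ⟨S, hS, hprob, hgen⟩ :=
    exists_measurableSet_forall_trueRisk_sub_le hL hR₂ hℓ hR hint hn hα hα₁ F lam hB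
  refine ⟨S, hS, hprob, fun D hD θ hemp hθ => ?_⟩
  have hI := integrable_trueRisk_add hmono hsub h₀ hL.le hℓ hR hint n lam σ θ
  refine ⟨hI.sub (integrable_const _), ?_⟩
  have hnoise := hG ▸ integral_trueRisk_add_le hmono hsub h₀ hL.le hℓ hR hint n hlam₀.le hσ₀.le θ
  have hrate := noise_rate_le hL hR₂ hG₀ hε hs₀.le hn hlam hσ
  have hgen := hgen D hD θ hθ hemp
  rw [integral_sub hI (integrable_const _), integral_const, probReal_univ, one_smul]
  have hbound : 8 * (1 + B * ε * √(Real.log (2 / α)) / (G * s)) * (L * R₂ * G * s / (ε * √n))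
      = 8 * (L * R₂ * G * s / (ε * √n)) + 8 * (L * R₂ * B * √(Real.log (2 / α)) / √n) := by
    field_simp
  have hpos : 0 ≤ L * R₂ * B * √(Real.log (2 / α)) / √n := by positivity
  linarith

open MeasureTheory SparsePrivateERM in
theorem theorem1 :
    ∃ C : ℝ, 0 < C ∧
      ∀ (p n : ℕ) (_ : 0 < p) (_ : 0 < n)
        -- the set function
        (F : Finset (Fin p) → ℝ) (_ : Monotone F) (_ : IsSubmodular F)
        (_ : F ∅ = 0) (_ : ∀ i, 0 < F {i})
        -- the loss, the data distribution and the domain of the parameter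
        (ℓ : ℝ → ℝ → ℝ) (L R₂ : ℝ) (_ : 0 < L) (_ : 0 < R₂)
        (_ : ∀ y u v, |ℓ u y - ℓ v y| ≤ L * |u - v|)
        (Dist : Measure (DataPoint p)) (_ : IsProbabilityMeasure Dist)
        (_ : ∀ᵐ d ∂Dist, ‖d.1‖ ≤ R₂)
        (_ : ∀ θ, Integrable (glmLoss ℓ θ) Dist)
        (Θ : Set (EuclideanSpace ℝ (Fin p))) (B : ℝ)
        -- the privacy parameters and the confidence level
        (ε δ α : ℝ) (_ : 0 < ε) (_ : 0 < δ) (_ : δ ≤ 1) (_ : 0 < α) (_ : α < 1)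
        -- the Gaussian width, the regularization parameter and the noise level
        (G lam σ : ℝ) (_ : G = gaussianWidth (symPolyhedron F))
        (_ : lam = L * R₂ * √n / G)
        (_ : σ = 4 * L * R₂ * √(Real.log (1 / δ) + ε) / (lam * ε))
        -- a minimizer of the true risk
        (θstar : EuclideanSpace ℝ (Fin p))
        (_ : IsArgmin (trueRisk n ℓ F lam Dist) Θ θstar) (_ : ‖θstar‖ ≤ B),
        ∃ E : Set (Fin n → DataPoint p), MeasurableSet E ∧
          ENNReal.ofReal (1 - α) ≤ Measure.pi (fun _ : Fin n => Dist) E ∧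
          ∀ D ∈ E, ∀ θhat, IsArgmin (empRisk ℓ F lam D) Θ θhat → ‖θhat‖ ≤ B →
            Integrable
              (fun b => trueRisk n ℓ F lam Dist (θhat + b) - trueRisk n ℓ F lam Dist θstar)
              (isotropicGaussian p σ) ∧
            ∫ b, (trueRisk n ℓ F lam Dist (θhat + b) - trueRisk n ℓ F lam Dist θstar)
                ∂(isotropicGaussian p σ)
              ≤ C * (1 + B * ε * √(Real.log (2 / α)) / (G * √(Real.log (1 / δ) + ε)))
                  * (L * R₂ * G * √(Real.log (1 / δ) + ε) / (ε * √n)) := by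
  refine ⟨8, by norm_num, fun p n hp hn F hmono hsub h₀ hF ℓ L R₂ hL hR₂ hℓ Dist _ hR hint Θ B
    ε δ α hε hδ hδ₁ hα hα₁ G lam σ hG hlam hσ θstar hstar hB => ?_⟩
  obtain ⟨E, hE, hprob, hrisk⟩ := theorem1_general hn hmono hsub h₀ ⟨⟨0, hp⟩, hF _⟩ hL hR₂ hℓ hR
    hint hε hδ hδ₁ hα hα₁.le hG hlam hσ hB
  exact ⟨E, hE, hprob, fun D hD θhat hhat => hrisk D hD θhat (hhat.2 θstar hstar.1)⟩
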